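/- All graphs are finite and simple. A graph is planar if it can be drawn in the plane, with vertices as distinct points and edges as simple arcs between their ends, so that arcs contain no vertices other than their ends and meet only at common ends. A $1$-selection of a graph $G$ is a map $f : V(G) \to E(G) \cup \{\emptyset\}$ such that for every vertex $v$ either $f(v) = \emptyset$ or $f(v)$ is an edge incident with $v$. Let $G_f$ be the graph obtained from $G$ by deleting all edges in $f(V(G))$ (and keeping all vertices). The robust chromatic number of $G$ is $\chi_1(G) = \min_f \chi(G_f)$, the minimum over all $1$-selections $f$ of $G$ of the chromatic number of $G_f$. Theorem. There is an infinite family of planar graphs $G$ with $\chi_1(G) = 3$; that is, there is an infinite sequence of pairwise non-isomorphic planar graphs $G_0, G_1, G_2, \dots$ such that $\chi_1(G_i) = 3$ for every $i$. -/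

import Mathlib

namespace SimpleGraph

variable {V : Type*}

/-- A drawing of the simple graph `G` in the plane `ℝ × ℝ` without crossings. Vertices are
distinct points, and each edge is a simple arc joining the points of its two ends. -/
structure PlaneDrawing (G : SimpleGraph V) where
  /-- the point representing a vertex -/
  point : V → ℝ × ℝ
  /-- the parametrized arc representing an edge -/
  arc : G.edgeSet → unitInterval → ℝ × ℝ
  point_injective : Function.Injective point
  arc_continuous : ∀ e, Continuous (arc e)
  arc_injective : ∀ e, Function.Injective (arc e)
  /-- the end points of the arc of `e` represent the two ends of `e`, in some order -/
  arc_ends : ∀ e, s(arc e 0, arc e 1) = Sym2.map point (e : Sym2 V)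
  /-- an arc passes through no vertex other than its two ends -/
  mem_of_point_mem_arc : ∀ e v, point v ∈ Set.range (arc e) → v ∈ (e : Sym2 V)
  /-- two different arcs meet only in vertices -/
  arcs_meet : ∀ e e', e ≠ e' → Set.range (arc e) ∩ Set.range (arc e') ⊆ Set.range point

/-- A graph is planar if it has a drawing in the plane without crossings. -/
def IsPlanar (G : SimpleGraph V) : Prop :=
  Nonempty G.PlaneDrawing

/-- A `1`-selection assigns to every vertex `v` an edge incident with `v`, or nothing
(`none` stands for the value `∅`). -/
def IsOneSelection (G : SimpleGraph V) (f : V → Option G.edgeSet) : Prop :=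
  ∀ (v : V) (e : G.edgeSet), f v = some e → v ∈ (e : Sym2 V)

/-- The set of all the edges that are selected by `f`. -/
def selectionSet (G : SimpleGraph V) (f : V → Option G.edgeSet) : Set (Sym2 V) :=
  {e | ∃ (v : V) (e' : G.edgeSet), f v = some e' ∧ (e' : Sym2 V) = e}

/-- The `1`-removed subgraph `G_f`: all the vertices of `G`, and the edges not selected by `f`. -/
def oneRemoved (G : SimpleGraph V) (f : V → Option G.edgeSet) : SimpleGraph V :=
  G.deleteEdges (G.selectionSet f)

/-- The robust chromatic number `χ₁(G)`: the minimum of the chromatic numbers of the graphs `G_f`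
over all `1`-selections `f` of `G`. (The set below is nonempty, as `f` may be `∅` everywhere, and
`ℕ∞` is well-ordered, so that the infimum is a minimum.) -/
noncomputable def robustChromaticNumber (G : SimpleGraph V) : ℕ∞ :=
  sInf {c | ∃ f : V → Option G.edgeSet, G.IsOneSelection f ∧ c = (G.oneRemoved f).chromaticNumber}

end SimpleGraph

/-!
A graph has `χ₁ ≤ k` if and only if its vertices have a `k`-colouring together with a choice of at
most one neighbour for every vertex such that every monochromatic edge is chosen from one of its
ends (`SimpleGraph.robustChromaticNumber_le_iff`). So a `2`-colouring is excluded as soon as some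
set of vertices meets too many monochromatic edges that can be chosen only from this set.

This is achieved in two stages. The gadget is a triangulation of a triangle with seven inner
vertices which, in the dual, plays the role of Tutte's fragment: if the apex of the triangle has
one colour and the other two corners have the other colour, then the inner vertices alone cannot
choose all the monochromatic edges inside the triangle, so a corner must choose one of them
(`exists_overloaded`, `exists_corner_pick`). The base triangulation arises from `K₄` by stacking a
vertex into three of its four triangles; each of the resulting nine triangles around the stacked
vertices is filled with a gadget whose apex is the stacked vertex. A triangulation on `N` vertices
with `μ` monochromatic faces has `N - 2 + μ` monochromatic edges. Since no `2`-colouring of `K₄` is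
close to proper, the monochromatic edges of the base and the gadgets with the critical colouring
are together always more than the seven base vertices, which would have to choose an edge in each of
them (`base_overloaded`, `core_not_two_colorable`). An explicit `3`-colouring shows that three
colours are enough.

To get infinitely many graphs, arbitrarily many vertices are joined to both ends of the edge `01`
on the outer face. Planarity is proved by a straight-line drawing with integral coordinates: the
core is checked edge by edge with orientation tests, and the additional triangles are drawn
on the other side of the line through `0` and `1` (`Link.clear`, `pagedCore_isPlanar`).
-/

/-! ### The graphs -/

/-- The edges of the base triangulation: `K₄` on `0, 1, 2, 3` together with the vertices
`4, 5, 6`, each stacked into one of the three triangles of `K₄` at `3`. -/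
def baseEdges : List (ℕ × ℕ) :=
  [(0, 1), (0, 2), (1, 2), (0, 3), (1, 3), (2, 3), (0, 4), (1, 4), (3, 4),
    (1, 5), (2, 5), (3, 5), (0, 6), (2, 6), (3, 6)]

/-- The base triangles that are filled with a gadget, the apex first. The other two vertices are
the ends of the edge opposite to the apex, which is always an edge of `K₄`. -/
def gadgetTriangles : List (ℕ × ℕ × ℕ) :=
  [(4, 0, 1), (4, 1, 3), (4, 0, 3), (5, 1, 2), (5, 2, 3), (5, 1, 3), (6, 0, 2), (6, 2, 3),
    (6, 0, 3)]

/-- The edges of the gadget, apart from the three edges of the surrounding triangle. The corners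
of the triangle are `0` (the apex), `1` and `2`, the inner vertices are `3, …, 9`. -/
def gadgetEdges : List (ℕ × ℕ) :=
  [(0, 6), (0, 7), (1, 3), (1, 4), (1, 5), (1, 6), (2, 5), (2, 7), (2, 8), (3, 4), (3, 6), (3, 9),
    (4, 5), (4, 8), (4, 9), (5, 8), (6, 7), (6, 9), (7, 8), (7, 9), (8, 9)]

/-- The vertex of the whole graph that plays the role of the vertex `j` in the gadget `g`. -/
def gadgetVertex (g j : ℕ) : ℕ :=
  match j with
  | 0 => (gadgetTriangles.getD g 0).1
  | 1 => (gadgetTriangles.getD g 0).2.1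
  | 2 => (gadgetTriangles.getD g 0).2.2
  | k + 3 => 7 * g + 7 + k

/-- The edges of the core: the base triangulation with its nine gadgets, on the vertices
`0, …, 69`. -/
def coreEdges : List (ℕ × ℕ) :=
  baseEdges ++ (List.range 9).flatMap fun g ↦
    gadgetEdges.map fun e ↦ (gadgetVertex g e.1, gadgetVertex g e.2)

/-- The edges of the graph on `ℕ` that has all the graphs `pagedCore i` as induced subgraphs,
written with the smaller end first: the core, and a page (triangle) `0, 1, v` for every `v ≥ 70`. -/
def Link (u v : ℕ) : Prop :=
  (u, v) ∈ coreEdges ∨ (u < 2 ∧ 70 ≤ v)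

theorem coreEdges_lt : ∀ e ∈ coreEdges, e.1 < e.2 ∧ e.2 < 70 := by decide +kernel

theorem Link.lt {u v : ℕ} (h : Link u v) : u < v := by
  rcases h with h | h
  · exact (coreEdges_lt _ h).1
  · omega

/-- The core together with `i` pages glued to the edge `01`. -/
def pagedCore (i : ℕ) : SimpleGraph (Fin (70 + i)) where
  Adj u v := Link u v ∨ Link v u
  symm := ⟨fun _ _ h ↦ h.symm⟩
  loopless := ⟨fun _ h ↦ (h.elim Link.lt Link.lt).false⟩

/-! ### A straight-line drawing -/

/-- The positions of the seven base vertices, up to a factor `10`. -/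
def basePlace (v : ℕ) : ℤ × ℤ :=
  [(0, 0), (11, 0), (4, 11), (6, 6), (5, 1), (7, 6), (3, 5)].getD v (0, 0)

/-- Barycentric coordinates, up to a factor `10`, of the inner vertices of a gadget with respect
to the surrounding triangle. -/
def gadgetWeight (k : ℕ) : ℤ × ℤ × ℤ :=
  [(2, 7, 1), (1, 6, 3), (1, 4, 5), (3, 6, 1), (4, 2, 4), (3, 3, 4), (2, 5, 3)].getD k 0

/-- The point that represents the vertex `v`. The core lies in the upper half-plane, with `0` and
`1` on the axis, and the tips of the pages are on a vertical line in the lower half-plane. -/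
def place (v : ℕ) : ℤ × ℤ :=
  if v < 7 then (10 * (basePlace v).1, 10 * (basePlace v).2)
  else if v < 70 then
    let t := gadgetTriangles.getD ((v - 7) / 7) 0
    let w := gadgetWeight ((v - 7) % 7)
    (w.1 * (basePlace t.1).1 + w.2.1 * (basePlace t.2.1).1 + w.2.2 * (basePlace t.2.2).1,
      w.1 * (basePlace t.1).2 + w.2.1 * (basePlace t.2.1).2 + w.2.2 * (basePlace t.2.2).2)
  else (1, 69 - v)

/-- Twice the signed area of the triangle `pqr`. -/
def orient (p q r : ℤ × ℤ) : ℤ :=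
  (q.1 - p.1) * (r.2 - p.2) - (q.2 - p.2) * (r.1 - p.1)

/-- A sufficient condition for the segments `ab` and `cd` to meet at most in a common end: one of
them lies strictly on one side of the line through the other, or they share an end and have
different directions. -/
def Clear (a b c d : ℕ) : Prop :=
  0 < orient (place a) (place b) (place c) * orient (place a) (place b) (place d) ∨
  0 < orient (place c) (place d) (place a) * orient (place c) (place d) (place b) ∨
  ((a = c ∨ a = d ∨ b = c ∨ b = d) ∧
    (orient (place a) (place b) (place c) ≠ 0 ∨ orient (place a) (place b) (place d) ≠ 0))

instance (a b c d : ℕ) : Decidable (Clear a b c d) := by unfold Clear; infer_instance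

theorem coreEdges_pairwise_clear :
    coreEdges.Pairwise fun e f ↦ Clear e.1 e.2 f.1 f.2 := by
  decide +kernel

/-- A drawing with straight edges. It suffices to check that any two different edges meet only in
points that represent common ends, provided that there are no isolated vertices. -/
theorem SimpleGraph.isPlanar_of_straight {V : Type*} [LinearOrder V] (G : SimpleGraph V)
    (P : V → ℝ × ℝ) (hP : Function.Injective P) (hdeg : ∀ v, ∃ w, G.Adj v w)
    (hcross : ∀ a b c d, a < b → c < d → G.Adj a b → G.Adj c d → (a, b) ≠ (c, d) →
      ∀ s t : ℝ, AffineMap.lineMap (P a) (P b) s = AffineMap.lineMap (P c) (P d) t →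
      s ∈ Set.Icc (0 : ℝ) 1 → t ∈ Set.Icc (0 : ℝ) 1 →
      ∃ v, (v = a ∨ v = b) ∧ (v = c ∨ v = d) ∧ AffineMap.lineMap (P a) (P b) s = P v) :
    G.IsPlanar := by
  have key : ∀ e : G.edgeSet, ∃ a b, a < b ∧ G.Adj a b ∧ (e : Sym2 V) = s(a, b) := by
    rintro ⟨e, he⟩
    induction e with | _ a b
    rcases (G.ne_of_adj he).lt_or_gt with h | h
    · exact ⟨a, b, h, he, rfl⟩
    · exact ⟨b, a, h, G.adj_symm he, Sym2.eq_swap⟩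
  choose a b hab hadj he using key
  let arc : G.edgeSet → unitInterval → ℝ × ℝ :=
    fun e t ↦ AffineMap.lineMap (P (a e)) (P (b e)) (t : ℝ)
  have meet : ∀ e e', e ≠ e' → ∀ x ∈ Set.range (arc e) ∩ Set.range (arc e'),
      ∃ v, v ∈ (e : Sym2 V) ∧ v ∈ (e' : Sym2 V) ∧ x = P v := by
    rintro e e' hne x ⟨⟨s, rfl⟩, ⟨t, ht⟩⟩
    obtain ⟨v, h1, h2, h3⟩ := hcross (a e) (b e) (a e') (b e') (hab e) (hab e') (hadj e) (hadj e')
      (fun h ↦ hne (Subtype.ext (by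
        have h1 : a e = a e' := congrArg Prod.fst h
        have h2 : b e = b e' := congrArg Prod.snd h
        rw [he e, he e', h1, h2]))) s t ht.symm s.2 t.2
    exact ⟨v, by rw [he e]; exact Sym2.mem_iff.2 h1, by rw [he e']; exact Sym2.mem_iff.2 h2, h3⟩
  refine ⟨⟨P, arc, hP, ?_, ?_, ?_, ?_, ?_⟩⟩
  · intro e
    exact AffineMap.lineMap_continuous.comp continuous_subtype_val
  · intro e s t h
    exact Subtype.ext (AffineMap.lineMap_injective ℝ (hP.ne (hab e).ne) h)
  · intro e
    simp [arc, he e]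
  · intro e v hv
    -- a vertex on the arc of `e` is the end of some edge, which meets `e` in that vertex
    by_contra hne
    obtain ⟨w, hw⟩ := hdeg v
    let e' : G.edgeSet := ⟨s(v, w), hw⟩
    have hv' : P v ∈ Set.range (arc e') := by
      have hmem : v = a e' ∨ v = b e' := by
        rw [← Sym2.mem_iff, ← he e']
        exact Sym2.mem_mk_left v w
      rcases hmem with h | h
      · exact ⟨0, by simp [arc, ← h]⟩
      · exact ⟨1, by simp [arc, ← h]⟩
    obtain ⟨u, h1, -, h3⟩ := meet e e'
      (fun h ↦ hne (by rw [h]; exact Sym2.mem_mk_left v w)) _ ⟨hv, hv'⟩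
    exact hne (hP h3 ▸ h1)
  · intro e e' hne x hx
    obtain ⟨v, -, -, rfl⟩ := meet e e' hne x hx
    exact ⟨v, rfl⟩

/-- `place v` as a point of the real plane. -/
def realPlace (v : ℕ) : ℝ × ℝ :=
  ((place v).1, (place v).2)

theorem Clear.symm {a b c d : ℕ} (h : Clear a b c d) : Clear c d a b := by
  rcases h with h | h | ⟨h, h'⟩
  · exact Or.inr (Or.inl h)
  · exact Or.inl h
  · refine Or.inr (Or.inr ⟨by tauto, ?_⟩)
    rcases h with rfl | rfl | rfl | rfl
    · rcases h' with h' | h'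
      · exact absurd (by unfold orient; ring) h'
      · exact Or.inr fun h0 ↦ h' (by unfold orient at *; linarith)
    · rcases h' with h' | h'
      · exact Or.inr fun h0 ↦ h' (by unfold orient at *; linarith)
      · exact absurd (by unfold orient; ring) h'
    · rcases h' with h' | h'
      · exact absurd (by unfold orient; ring) h'
      · exact Or.inl fun h0 ↦ h' (by unfold orient at *; linarith)
    · rcases h' with h' | h'
      · exact Or.inl fun h0 ↦ h' (by unfold orient at *; linarith)
      · exact absurd (by unfold orient; ring) h'

/-- A segment `cd` strictly on one side of the line `ab` does not meet it. -/
theorem not_meet_of_orient {a b c d : ℕ}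
    (h : 0 < orient (place a) (place b) (place c) * orient (place a) (place b) (place d))
    {s t : ℝ} (ht : t ∈ Set.Icc (0 : ℝ) 1)
    (hst : AffineMap.lineMap (realPlace a) (realPlace b) s =
      AffineMap.lineMap (realPlace c) (realPlace d) t) : False := by
  have h1 := congrArg Prod.fst hst
  have h2 := congrArg Prod.snd hst
  simp only [AffineMap.lineMap_apply_module', realPlace, Prod.fst_add, Prod.snd_add, Prod.smul_fst,
    Prod.smul_snd, Prod.fst_sub, Prod.snd_sub, smul_eq_mul] at h1 h2
  have hR : (0 : ℝ) < (orient (place a) (place b) (place c) : ℝ) *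
      (orient (place a) (place b) (place d) : ℝ) := by exact_mod_cast h
  -- the signed area is an affine function of the third vertex, and vanishes on the line `ab`
  have key : (1 - t) * (orient (place a) (place b) (place c) : ℝ) +
      t * (orient (place a) (place b) (place d) : ℝ) = 0 := by
    unfold orient
    push_cast
    linear_combination (((place b).2 : ℝ) - (place a).2) * h1 -
      (((place b).1 : ℝ) - (place a).1) * h2
  obtain ⟨ht0, ht1⟩ := ht
  rcases mul_pos_iff.1 hR with ⟨hc, hd⟩ | ⟨hc, hd⟩ <;> rcases ht0.eq_or_lt with rfl | ht0
  · linarith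
  · nlinarith [mul_pos ht0 hd, mul_nonneg (sub_nonneg.2 ht1) hc.le]
  · linarith
  · nlinarith [mul_neg_of_pos_of_neg ht0 hd, mul_nonpos_of_nonneg_of_nonpos (sub_nonneg.2 ht1) hc.le]

/-- Two segments with a common end and different directions meet in this end only. -/
theorem meet_of_orient {a b d : ℕ} (h : orient (place a) (place b) (place d) ≠ 0) {s t : ℝ}
    (hst : AffineMap.lineMap (realPlace a) (realPlace b) s =
      AffineMap.lineMap (realPlace a) (realPlace d) t) : s = 0 ∧ t = 0 := by
  have h1 := congrArg Prod.fst hst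
  have h2 := congrArg Prod.snd hst
  simp only [AffineMap.lineMap_apply_module', realPlace, Prod.fst_add, Prod.snd_add, Prod.smul_fst,
    Prod.smul_snd, Prod.fst_sub, Prod.snd_sub, smul_eq_mul] at h1 h2
  have hR : (orient (place a) (place b) (place d) : ℝ) ≠ 0 := by exact_mod_cast h
  constructor
  · refine (mul_eq_zero.1 ?_).resolve_right hR
    unfold orient
    push_cast
    linear_combination (((place d).2 : ℝ) - (place a).2) * h1 -
      (((place d).1 : ℝ) - (place a).1) * h2
  · refine (mul_eq_zero.1 ?_).resolve_right hR
    unfold orient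
    push_cast
    linear_combination (((place b).2 : ℝ) - (place a).2) * h1 -
      (((place b).1 : ℝ) - (place a).1) * h2

theorem Clear.meet {a b c d : ℕ} (h : Clear a b c d) {s t : ℝ}
    (hs : s ∈ Set.Icc (0 : ℝ) 1) (ht : t ∈ Set.Icc (0 : ℝ) 1)
    (hst : AffineMap.lineMap (realPlace a) (realPlace b) s =
      AffineMap.lineMap (realPlace c) (realPlace d) t) :
    ∃ v, (v = a ∨ v = b) ∧ (v = c ∨ v = d) ∧
      AffineMap.lineMap (realPlace a) (realPlace b) s = realPlace v := by
  rcases h with h | h | ⟨h, h'⟩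
  · exact (not_meet_of_orient h ht hst).elim
  · exact (not_meet_of_orient h hs hst.symm).elim
  · -- each segment is reversed where needed, so that the common end comes first
    rcases h with rfl | rfl | rfl | rfl
    · refine ⟨a, by simp, by simp, ?_⟩
      have := meet_of_orient (a := a) (b := b) (d := d)
        (h'.resolve_left (not_not.2 (by unfold orient; ring))) hst
      simp [this.1]
    · rw [← AffineMap.lineMap_apply_one_sub (realPlace a) (realPlace c)] at hst
      refine ⟨a, by simp, by simp, ?_⟩
      have := meet_of_orient (a := a) (b := b) (d := c)
        (h'.resolve_right (not_not.2 (by unfold orient; ring))) hst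
      simp [this.1]
    · rw [← AffineMap.lineMap_apply_one_sub (realPlace b) (realPlace a)] at hst ⊢
      refine ⟨b, by simp, by simp, ?_⟩
      have := meet_of_orient (a := b) (b := a) (d := d) (fun h0 ↦
        h'.resolve_left (not_not.2 (by unfold orient; ring)) (by unfold orient at *; linarith)) hst
      rw [this.1]; simp
    · rw [← AffineMap.lineMap_apply_one_sub (realPlace b) (realPlace a),
        ← AffineMap.lineMap_apply_one_sub (realPlace b) (realPlace c)] at hst
      rw [← AffineMap.lineMap_apply_one_sub (realPlace b) (realPlace a)]
      refine ⟨b, by simp, by simp, ?_⟩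
      have := meet_of_orient (a := b) (b := a) (d := c) (fun h0 ↦
        h'.resolve_right (not_not.2 (by unfold orient; ring)) (by unfold orient at *; linarith)) hst
      rw [this.1]; simp

theorem place_of_le {v : ℕ} (hv : 70 ≤ v) : place v = (1, 69 - (v : ℤ)) := by
  unfold place
  rw [if_neg (by omega), if_neg (by omega)]

theorem place_zero : place 0 = (0, 0) := by decide +kernel

theorem place_one : place 1 = (110, 0) := by decide +kernel

/-- The core lies in a half-strip, and has no vertices other than `0` and `1` in its corners. -/
theorem place_core : ∀ v < 70, 0 ≤ (place v).1 ∧ (place v).1 ≤ 110 ∧ 0 ≤ (place v).2 ∧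
    (v ≠ 0 → 0 < (place v).1 + (place v).2) ∧ (v ≠ 1 → 0 < 110 - (place v).1 + (place v).2) := by
  decide +kernel

theorem place_core_injective : ∀ u < 70, ∀ v < 70, place u = place v → u = v := by
  decide +kernel

theorem place_injective : Function.Injective place := by
  intro u v h
  wlog huv : u ≤ v generalizing u v
  · exact (this h.symm (by omega)).symm
  rcases lt_or_ge v 70 with hv | hv
  · exact place_core_injective u (by omega) v hv h
  · rw [place_of_le hv] at h
    rcases lt_or_ge u 70 with hu | hu
    · have := (place_core u hu).2.2.1
      rw [h] at this
      simp at this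
      omega
    · rw [place_of_le hu] at h
      simp at h
      omega

/-- Seen from the page edge from `p ∈ {0, 1}` to `v`, all the vertices of the core other than `p`
are strictly on the inner side. -/
theorem orient_page {p v c : ℕ} (hp : p < 2) (hv : 70 ≤ v) (hc : c < 70) (hcp : c ≠ p) :
    (p = 0 → 0 < orient (place p) (place v) (place c)) ∧
      (p = 1 → orient (place p) (place v) (place c) < 0) := by
  obtain ⟨h1, h2, h3, h4, h5⟩ := place_core c hc
  have hv' : (70 : ℤ) ≤ v := by exact_mod_cast hv
  constructor
  · rintro rfl
    have := h4 hcp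
    rw [place_of_le hv, place_zero]
    simp only [orient]
    nlinarith
  · rintro rfl
    have := h5 hcp
    rw [place_of_le hv, place_one]
    simp only [orient]
    nlinarith

theorem clear_page_core {p v c d : ℕ} (hp : p < 2) (hv : 70 ≤ v) (hcd : c < d) (hd : d < 70) :
    Clear p v c d := by
  have hc : c < 70 := by omega
  by_cases h1 : c = p
  · subst h1
    have := orient_page hp hv hd hcd.ne'
    refine Or.inr (Or.inr ⟨Or.inl rfl, Or.inr ?_⟩)
    rcases (by omega : c = 0 ∨ c = 1) with h | h
    · exact (this.1 h).ne'
    · exact (this.2 h).ne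
  by_cases h2 : d = p
  · subst h2
    have := orient_page hp hv hc h1
    refine Or.inr (Or.inr ⟨Or.inr (Or.inl rfl), Or.inl ?_⟩)
    rcases (by omega : d = 0 ∨ d = 1) with h | h
    · exact (this.1 h).ne'
    · exact (this.2 h).ne
  have hc' := orient_page hp hv hc h1
  have hd' := orient_page hp hv hd h2
  refine Or.inl ?_
  rcases (by omega : p = 0 ∨ p = 1) with h | h
  · exact mul_pos (hc'.1 h) (hd'.1 h)
  · exact mul_pos_of_neg_of_neg (hc'.2 h) (hd'.2 h)

/-- Of two pages, the one with the lower tip has the other one on its inner side. -/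
theorem clear_page_page {p v q w : ℕ} (hp : p < 2) (hv : 70 ≤ v) (hq : q < 2) (hw : 70 ≤ w)
    (hne : (p, v) ≠ (q, w)) : Clear p v q w := by
  wlog hwv : w ≤ v generalizing p v q w
  · exact (this hq hw hp hv hne.symm (by omega)).symm
  have hv' : (70 : ℤ) ≤ v := by exact_mod_cast hv
  have hw' : (70 : ℤ) ≤ w := by exact_mod_cast hw
  rcases hwv.eq_or_lt with rfl | hlt
  · have hpq : p ≠ q := fun h ↦ hne (by rw [h])
    refine Or.inr (Or.inr ⟨by simp, Or.inl ?_⟩)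
    have := orient_page hp hv (c := q) (by omega) hpq.symm
    rcases (by omega : p = 0 ∨ p = 1) with h | h
    · exact (this.1 h).ne'
    · exact (this.2 h).ne
  · have hlt' : (w : ℤ) < v := by exact_mod_cast hlt
    have hin : (p = 0 → 0 < orient (place p) (place v) (place w)) ∧
        (p = 1 → orient (place p) (place v) (place w) < 0) := by
      rw [place_of_le hv, place_of_le hw]
      constructor <;> rintro rfl
      · rw [place_zero]; simp only [orient]; linarith
      · rw [place_one]; simp only [orient]; linarith
    by_cases hpq : p = q
    · subst hpq
      refine Or.inr (Or.inr ⟨Or.inl rfl, Or.inr ?_⟩)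
      rcases (by omega : p = 0 ∨ p = 1) with h | h
      · exact (hin.1 h).ne'
      · exact (hin.2 h).ne
    · have := orient_page hp hv (c := q) (by omega) (Ne.symm hpq)
      refine Or.inl ?_
      rcases (by omega : p = 0 ∨ p = 1) with h | h
      · exact mul_pos (this.1 h) (hin.1 h)
      · exact mul_pos_of_neg_of_neg (this.2 h) (hin.2 h)

theorem Link.clear {a b c d : ℕ} (h : Link a b) (h' : Link c d) (hne : (a, b) ≠ (c, d)) :
    Clear a b c d := by
  unfold Link at h h'
  have hclear := coreEdges_pairwise_clear
  have hlt := coreEdges_lt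
  -- generalized, since unification would unfold the explicit list
  generalize coreEdges = l at h h' hclear hlt
  have hsymm : Std.Symm fun e f : ℕ × ℕ ↦ Clear e.1 e.2 f.1 f.2 := ⟨fun _ _ ↦ Clear.symm⟩
  rcases h with h | h <;> rcases h' with h' | h'
  · have hcd := List.Pairwise.forall hclear h h' hne
    exact hcd
  · exact (clear_page_core h'.1 h'.2 (hlt _ h).1 (hlt _ h).2).symm
  · exact clear_page_core h.1 h.2 (hlt _ h').1 (hlt _ h').2
  · exact clear_page_page h.1 h.2 h'.1 h'.2 hne

theorem exists_coreEdge : ∀ v < 70, ∃ e ∈ coreEdges, e.1 = v ∨ e.2 = v := by decide +kernel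

theorem pagedCore_isPlanar (i : ℕ) : (pagedCore i).IsPlanar := by
  refine SimpleGraph.isPlanar_of_straight _ (fun v ↦ realPlace v) ?_ ?_ ?_
  · intro u v h
    refine Fin.ext (place_injective ?_)
    simpa [realPlace, Prod.ext_iff] using h
  · rintro ⟨v, hv⟩
    rcases lt_or_ge v 70 with h | h
    · obtain ⟨e, he, rfl | rfl⟩ := exists_coreEdge v h
      · exact ⟨⟨e.2, by have := coreEdges_lt e he; omega⟩, Or.inl (Or.inl he)⟩
      · exact ⟨⟨e.1, by have := coreEdges_lt e he; omega⟩, Or.inr (Or.inl he)⟩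
    · exact ⟨⟨0, by omega⟩, Or.inr (Or.inr ⟨by norm_num, h⟩)⟩
  · intro a b c d hab hcd h h' hne s t hst hs ht
    have hl : Link a b := h.resolve_right fun h ↦ absurd h.lt (not_lt.2 hab.le)
    have hl' : Link c d := h'.resolve_right fun h ↦ absurd h.lt (not_lt.2 hcd.le)
    obtain ⟨v, h1, h2, h3⟩ := (hl.clear hl' fun h ↦ hne (by
      simpa [Prod.ext_iff, Fin.ext_iff] using h)).meet hs ht hst
    rcases h1 with rfl | rfl
    · exact ⟨a, Or.inl rfl, by simpa [Fin.ext_iff] using h2, h3⟩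
    · exact ⟨b, Or.inr rfl, by simpa [Fin.ext_iff] using h2, h3⟩

/-! ### The robust chromatic number -/

/-- A graph has a `1`-removed subgraph that is `k`-colourable if and only if it has a colouring in
which every monochromatic edge is picked by one of its ends, where every vertex picks at most one
neighbour. -/
theorem SimpleGraph.exists_colorable_oneRemoved_iff {V : Type*} (G : SimpleGraph V) (k : ℕ) :
    (∃ f, G.IsOneSelection f ∧ (G.oneRemoved f).Colorable k) ↔
      ∃ (C : V → Fin k) (pick : V → V),
        ∀ u v, G.Adj u v → C u = C v → pick u = v ∨ pick v = u := by
  classical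
  constructor
  · rintro ⟨f, hf, ⟨C⟩⟩
    have hpick : ∀ u, ∃ v, ∀ e, f u = some e → (e : Sym2 V) = s(u, v) := by
      intro u
      rcases h : f u with _ | e
      · exact ⟨u, by simp⟩
      · obtain ⟨v, hv⟩ := hf u e h
        exact ⟨v, by rintro _ ⟨⟩; exact hv⟩
    choose pick hpick using hpick
    refine ⟨C, pick, fun u v huv hC ↦ ?_⟩
    by_contra hne
    refine C.valid (v := u) (w := v) ?_ hC
    refine (SimpleGraph.deleteEdges_adj).2 ⟨huv, ?_⟩
    rintro ⟨w, e, hw, he⟩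
    have h := (hpick w e hw).symm.trans he
    have hw' : w = u ∨ w = v := Sym2.mem_iff.1 (h ▸ Sym2.mem_mk_left _ _)
    rcases hw' with rfl | rfl
    · exact hne (Or.inl (Sym2.congr_right.1 h))
    · exact hne (Or.inr (Sym2.congr_right.1 (h.trans Sym2.eq_swap)))
  · rintro ⟨C, pick, h⟩
    refine ⟨fun v ↦ if hv : G.Adj v (pick v) then some ⟨s(v, pick v), hv⟩ else none, ?_, ⟨C, ?_⟩⟩
    · intro v e hv
      dsimp only at hv
      split_ifs at hv
      cases hv
      exact Sym2.mem_mk_left _ _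
    · intro u v huv hC
      obtain ⟨huv, hsel⟩ := (SimpleGraph.deleteEdges_adj).1 huv
      refine hsel ?_
      rcases h u v huv hC with rfl | rfl
      · exact ⟨u, ⟨s(u, pick u), huv⟩, dif_pos huv, rfl⟩
      · exact ⟨v, ⟨s(v, pick v), huv.symm⟩, dif_pos huv.symm, Sym2.eq_swap⟩

theorem SimpleGraph.robustChromaticNumber_le_iff {V : Type*} (G : SimpleGraph V) (k : ℕ) :
    G.robustChromaticNumber ≤ k ↔ ∃ (C : V → Fin k) (pick : V → V),
      ∀ u v, G.Adj u v → C u = C v → pick u = v ∨ pick v = u := by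
  rw [← G.exists_colorable_oneRemoved_iff k]
  constructor
  · intro h
    have hne : {c | ∃ f, G.IsOneSelection f ∧ c = (G.oneRemoved f).chromaticNumber}.Nonempty :=
      ⟨_, fun _ ↦ none, fun _ _ h ↦ (Option.some_ne_none _ h.symm).elim, rfl⟩
    obtain ⟨f, hf, hc⟩ := csInf_mem hne
    refine ⟨f, hf, SimpleGraph.chromaticNumber_le_iff_colorable.1 (hc ▸ h)⟩
  · rintro ⟨f, hf, hc⟩
    have hle : G.robustChromaticNumber ≤ (G.oneRemoved f).chromaticNumber := sInf_le ⟨f, hf, rfl⟩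
    exact hle.trans (SimpleGraph.chromaticNumber_le_iff_colorable.2 hc)

/-! ### Three colours suffice -/

/-- A `3`-colouring of the core. -/
def coreColor (v : ℕ) : Fin 3 :=
  [0, 1, 2, 1, 2, 0, 1,
    0, 1, 2, 1, 0, 0, 2, 0, 2, 0, 2, 0, 2, 1, 0, 1, 2, 1, 0, 0, 2, 0, 2, 0, 2, 0, 1, 1, 0, 1, 0, 1,
    0, 2, 2, 0, 2, 0, 2, 0, 2, 1, 0, 2, 1, 2, 0, 0, 1, 0, 1, 0, 1, 0, 2, 2, 2, 1, 2, 0, 2, 0,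
    1].getD v 2

/-- The vertices that pick a neighbour, with the neighbours that they pick, so that all the
monochromatic edges of `coreColor` are picked. -/
def corePicks : List (ℕ × ℕ) :=
  [(1, 3), (3, 6), (7, 0), (12, 11), (17, 4), (19, 15), (21, 0), (26, 25), (32, 5), (34, 33),
    (39, 5), (41, 40), (46, 5), (47, 43), (49, 0), (54, 53), (59, 6), (62, 61), (66, 0), (69, 64)]

theorem coreColor_eq : ∀ e ∈ coreEdges, coreColor e.1 = coreColor e.2 →
    corePicks.lookup e.1 = some e.2 ∨ corePicks.lookup e.2 = some e.1 := by
  decide +kernel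

theorem coreColor_of_le {v : ℕ} (hv : 70 ≤ v) : coreColor v = 2 :=
  List.getD_eq_default _ _ hv

theorem robustChromaticNumber_pagedCore_le (i : ℕ) : (pagedCore i).robustChromaticNumber ≤ 3 := by
  refine ((pagedCore i).robustChromaticNumber_le_iff 3).2 ⟨fun v ↦ coreColor v, fun v ↦
    if h : (corePicks.lookup (v : ℕ)).getD v < 70 + i then ⟨_, h⟩ else v, ?_⟩
  have key : ∀ u v : Fin (70 + i), Link u v → coreColor u = coreColor v →
      corePicks.lookup (u : ℕ) = some (v : ℕ) ∨ corePicks.lookup (v : ℕ) = some (u : ℕ) := by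
    rintro u v (h | ⟨h, h'⟩) hC
    · exact coreColor_eq _ h hC
    · rw [coreColor_of_le h'] at hC
      rcases (by omega : (u : ℕ) = 0 ∨ (u : ℕ) = 1) with h | h <;>
        · rw [h] at hC
          exact absurd hC (by decide)
  have hpick : ∀ u v : Fin (70 + i), corePicks.lookup (u : ℕ) = some (v : ℕ) →
      (if h : (corePicks.lookup (u : ℕ)).getD u < 70 + i then (⟨_, h⟩ : Fin (70 + i)) else u)
        = v := by
    intro u v h
    simp [h]
  intro u v huv hC
  rcases huv with h | h
  · exact (key u v h hC).imp (hpick u v) (hpick v u)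
  · exact ((key v u h hC.symm).imp (hpick v u) (hpick u v)).symm

/-! ### Two colours do not suffice -/

/-- Whether the edge `e` is monochromatic in the colouring `κ`. -/
def IsMono (κ : ℕ → Bool) (e : ℕ × ℕ) : Prop := κ e.1 = κ e.2

instance (κ : ℕ → Bool) (e : ℕ × ℕ) : Decidable (IsMono κ e) := by unfold IsMono; infer_instance

/-- Sets of inner vertices of the gadget, one of which is overloaded in any `2`-colouring that is
as in `exists_overloaded`. -/
def overloadSets : List (List ℕ) :=
  [[3, 4, 5, 6, 7, 8, 9], [4, 6, 7, 9], [6, 7], [4, 8], [6, 8, 9]]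

/-- The key property of the gadget, which is dual to the Tutte fragment. If the apex of the gadget
has one colour and the other two corners have the other colour, then some set `W` of inner vertices
is overloaded: more than `|W|` monochromatic edges of the gadget have no inner ends outside `W`. -/
theorem exists_overloaded : ∀ b₀ b₃ b₄ b₅ b₆ b₇ b₈ b₉ : Bool, ∃ W ∈ overloadSets,
    W.length < (gadgetEdges.filter fun e ↦
      IsMono (fun j ↦ [b₀, !b₀, !b₀, b₃, b₄, b₅, b₆, b₇, b₈, b₉].getD j false) e ∧
        (e.1 < 3 ∨ e.1 ∈ W) ∧ e.2 ∈ W).length := by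
  decide +kernel

/-- In every `2`-colouring of the base triangulation, the number of monochromatic edges plus the
number of gadgets as in `exists_overloaded` exceeds the number `7` of base vertices. -/
theorem base_overloaded : ∀ b₀ b₁ b₂ b₃ b₄ b₅ b₆ : Bool,
    let κ : ℕ → Bool := fun j ↦ [b₀, b₁, b₂, b₃, b₄, b₅, b₆].getD j false
    7 < (baseEdges.filter fun e ↦ IsMono κ e).length +
      ((List.range 9).filter fun g ↦ κ (gadgetVertex g 0) ≠ κ (gadgetVertex g 1) ∧
        κ (gadgetVertex g 1) = κ (gadgetVertex g 2)).length := by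
  decide +kernel

theorem baseEdges_lt : ∀ e ∈ baseEdges, e.1 < e.2 ∧ e.2 < 7 := by decide

theorem gadgetEdges_lt : ∀ e ∈ gadgetEdges, e.1 < e.2 ∧ 3 ≤ e.2 ∧ e.2 < 10 := by decide

theorem gadgetVertex_of_le {g j : ℕ} (hj : 3 ≤ j) : gadgetVertex g j = 7 * g + 4 + j := by
  obtain ⟨k, rfl⟩ := Nat.exists_eq_add_of_le' hj
  simp only [gadgetVertex]
  omega

theorem gadgetVertex_corner_lt : ∀ g < 9, ∀ j < 3, gadgetVertex g j < 7 := by decide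

theorem gadgetVertex_injOn :
    ∀ g < 9, ∀ j < 10, ∀ k < 10, gadgetVertex g j = gadgetVertex g k → j = k := by
  decide +kernel

theorem mem_coreEdges_of_base {e : ℕ × ℕ} (he : e ∈ baseEdges) : e ∈ coreEdges :=
  List.mem_append_left _ he

theorem mem_coreEdges_of_gadget {g : ℕ} (hg : g < 9) {e : ℕ × ℕ} (he : e ∈ gadgetEdges) :
    (gadgetVertex g e.1, gadgetVertex g e.2) ∈ coreEdges :=
  List.mem_append_right _ (List.mem_flatMap.2 ⟨g, List.mem_range.2 hg, List.mem_map.2 ⟨e, he, rfl⟩⟩)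

/-- In a gadget as in `exists_overloaded`, the inner vertices cannot pick all the monochromatic
edges, so that some corner has to pick an edge of the gadget. -/
theorem exists_corner_pick {C : ℕ → Bool} {pick : ℕ → ℕ}
    (h : ∀ e ∈ coreEdges, C e.1 = C e.2 → pick e.1 = e.2 ∨ pick e.2 = e.1) {g : ℕ} (hg : g < 9)
    (h01 : C (gadgetVertex g 0) ≠ C (gadgetVertex g 1))
    (h12 : C (gadgetVertex g 1) = C (gadgetVertex g 2)) :
    ∃ e ∈ gadgetEdges, e.1 < 3 ∧ pick (gadgetVertex g e.1) = gadgetVertex g e.2 := by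
  by_contra hno
  push Not at hno
  obtain ⟨W, -, hlt⟩ := exists_overloaded (C (gadgetVertex g 0)) (C (gadgetVertex g 3))
    (C (gadgetVertex g 4)) (C (gadgetVertex g 5)) (C (gadgetVertex g 6)) (C (gadgetVertex g 7))
    (C (gadgetVertex g 8)) (C (gadgetVertex g 9))
  have h1 : (!C (gadgetVertex g 0)) = C (gadgetVertex g 1) := by
    revert h01; cases C (gadgetVertex g 0) <;> cases C (gadgetVertex g 1) <;> simp
  set κ : ℕ → Bool := fun j ↦ [C (gadgetVertex g 0), !C (gadgetVertex g 0), !C (gadgetVertex g 0),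
    C (gadgetVertex g 3), C (gadgetVertex g 4), C (gadgetVertex g 5), C (gadgetVertex g 6),
    C (gadgetVertex g 7), C (gadgetVertex g 8), C (gadgetVertex g 9)].getD j false
  have hκC : ∀ j < 10, κ j = C (gadgetVertex g j) := by
    intro j hj
    interval_cases j
    · rfl
    · exact h1
    · exact h1.trans h12
    all_goals rfl
  refine absurd hlt (not_lt.2 ?_)
  rw [← List.toFinset_card_of_nodup (List.Nodup.filter _ (by decide))]
  refine le_trans (Finset.card_le_card_of_forall_subsingleton (t := W.toFinset)
    (fun e w ↦ (w = e.1 ∧ pick (gadgetVertex g e.1) = gadgetVertex g e.2) ∨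
      (w = e.2 ∧ pick (gadgetVertex g e.2) = gadgetVertex g e.1)) ?_ ?_) (List.toFinset_card_le W)
  · intro e he
    simp only [List.mem_toFinset, List.mem_filter, decide_eq_true_eq] at he
    obtain ⟨he, hmono, hW1, hW2⟩ := he
    obtain ⟨hlt1, hlt2, hlt3⟩ := gadgetEdges_lt e he
    rw [IsMono, hκC _ (by omega), hκC _ hlt3] at hmono
    rcases h _ (mem_coreEdges_of_gadget hg he) hmono with hp | hp
    · rcases hW1 with hW1 | hW1
      · exact absurd hp (hno e he hW1)
      · exact ⟨e.1, by simpa using hW1, Or.inl ⟨rfl, hp⟩⟩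
    · exact ⟨e.2, by simpa using hW2, Or.inr ⟨rfl, hp⟩⟩
  · rintro w - e ⟨he, hew⟩ f ⟨hf, hfw⟩
    simp only [List.mem_toFinset, List.mem_filter] at he hf
    obtain ⟨he1, he2, he3⟩ := gadgetEdges_lt e he.1
    obtain ⟨hf1, hf2, hf3⟩ := gadgetEdges_lt f hf.1
    have inj := gadgetVertex_injOn g hg
    rcases hew with ⟨rfl, hp⟩ | ⟨rfl, hp⟩ <;> rcases hfw with ⟨hw, hq⟩ | ⟨hw, hq⟩ <;>
      rw [← hw] at hq <;> have heq := inj _ (by omega) _ (by omega) (hp.symm.trans hq)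
    · exact Prod.ext hw heq
    · omega
    · omega
    · exact Prod.ext heq hw

/-- There are more than seven monochromatic edges of the base and gadgets as in
`exists_overloaded`; each of them needs a base vertex to pick an edge in it, but there are only
seven base vertices. -/
theorem core_not_two_colorable (C : ℕ → Bool) (pick : ℕ → ℕ) :
    ¬ ∀ e ∈ coreEdges, C e.1 = C e.2 → pick e.1 = e.2 ∨ pick e.2 = e.1 := by
  intro h
  have hlt := base_overloaded (C 0) (C 1) (C 2) (C 3) (C 4) (C 5) (C 6)
  set κ : ℕ → Bool := fun j ↦ [C 0, C 1, C 2, C 3, C 4, C 5, C 6].getD j false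
  have hκC : ∀ j < 7, κ j = C j := by
    intro j hj
    interval_cases j <;> rfl
  refine absurd hlt (not_lt.2 ?_)
  rw [← List.toFinset_card_of_nodup (List.Nodup.filter _ (by decide)),
    ← List.toFinset_card_of_nodup (List.Nodup.filter _ List.nodup_range), ← Finset.card_disjSum]
  refine (Finset.card_le_card_of_forall_subsingleton (t := Finset.range 7)
    (fun z w ↦ Sum.elim
      (fun e : ℕ × ℕ ↦ (w = e.1 ∧ pick w = e.2) ∨ (w = e.2 ∧ pick w = e.1))
      (fun g ↦ ∃ e ∈ gadgetEdges, e.1 < 3 ∧ w = gadgetVertex g e.1 ∧ pick w = gadgetVertex g e.2)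
      z) ?_ ?_).trans_eq (Finset.card_range 7)
  · rintro (e | g) hz
    · simp only [Finset.inl_mem_disjSum, List.mem_toFinset, List.mem_filter,
        decide_eq_true_eq] at hz
      obtain ⟨he, hmono⟩ := hz
      obtain ⟨h1, h2⟩ := baseEdges_lt e he
      rw [IsMono, hκC _ (by omega), hκC _ h2] at hmono
      rcases h e (mem_coreEdges_of_base he) hmono with hp | hp
      · exact ⟨e.1, Finset.mem_range.2 (by omega), Or.inl ⟨rfl, hp⟩⟩
      · exact ⟨e.2, Finset.mem_range.2 (by omega), Or.inr ⟨rfl, hp⟩⟩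
    · simp only [Finset.inr_mem_disjSum, List.mem_toFinset, List.mem_filter, List.mem_range,
        decide_eq_true_eq] at hz
      obtain ⟨hg, h01, h12⟩ := hz
      have hlt := gadgetVertex_corner_lt g hg
      rw [hκC _ (hlt 0 (by omega)), hκC _ (hlt 1 (by omega))] at h01
      rw [hκC _ (hlt 1 (by omega)), hκC _ (hlt 2 (by omega))] at h12
      obtain ⟨e, he, he3, hp⟩ := exists_corner_pick h hg h01 h12
      exact ⟨gadgetVertex g e.1, Finset.mem_range.2 (hlt _ he3), e, he, he3, rfl, hp⟩
  · -- the edge picked by `w` determines whether it is a base edge, and which, or lies in a gadget,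
    -- and in which one
    rintro w hw (e | g) ⟨hz, hzw⟩ (f | k) ⟨hz', hzw'⟩
    all_goals simp only [Finset.inl_mem_disjSum, Finset.inr_mem_disjSum, List.mem_toFinset,
      List.mem_filter, Sum.elim_inl, Sum.elim_inr] at hz hzw hz' hzw'
    · obtain ⟨h1, h2⟩ := baseEdges_lt e hz.1
      obtain ⟨h3, h4⟩ := baseEdges_lt f hz'.1
      exact congrArg Sum.inl (Prod.ext (by omega) (by omega))
    · obtain ⟨h1, h2⟩ := baseEdges_lt e hz.1
      obtain ⟨f, hf, -, -, hp⟩ := hzw'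
      have hf3 := (gadgetEdges_lt f hf).2.1
      rw [gadgetVertex_of_le hf3] at hp
      omega
    · obtain ⟨h1, h2⟩ := baseEdges_lt f hz'.1
      obtain ⟨e, he, -, -, hp⟩ := hzw
      have he3 := (gadgetEdges_lt e he).2.1
      rw [gadgetVertex_of_le he3] at hp
      omega
    · obtain ⟨e, he, -, -, hp⟩ := hzw
      obtain ⟨f, hf, -, -, hq⟩ := hzw'
      obtain ⟨-, he3, he10⟩ := gadgetEdges_lt e he
      obtain ⟨-, hf3, hf10⟩ := gadgetEdges_lt f hf
      rw [gadgetVertex_of_le he3] at hp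
      rw [gadgetVertex_of_le hf3] at hq
      exact congrArg Sum.inr (by omega)

theorem not_robustChromaticNumber_pagedCore_le_two (i : ℕ) :
    ¬ (pagedCore i).robustChromaticNumber ≤ (2 : ℕ) := by
  rw [SimpleGraph.robustChromaticNumber_le_iff]
  rintro ⟨C, pick, h⟩
  refine core_not_two_colorable
    (fun v ↦ if hv : v < 70 + i then decide (C ⟨v, hv⟩ = 0) else false)
    (fun v ↦ if hv : v < 70 + i then pick ⟨v, hv⟩ else v) fun e he hC ↦ ?_
  obtain ⟨hlt, hlt'⟩ := coreEdges_lt e he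
  have h1 : e.1 < 70 + i := by omega
  have h2 : e.2 < 70 + i := by omega
  simp only [h1, h2, dif_pos] at hC ⊢
  have hC' : C ⟨e.1, h1⟩ = C ⟨e.2, h2⟩ := by
    rw [decide_eq_decide] at hC
    omega
  exact (h ⟨e.1, h1⟩ ⟨e.2, h2⟩ (Or.inl (Or.inl he)) hC').imp (congrArg Fin.val) (congrArg Fin.val)

/-- There are infinitely many pairwise non-isomorphic finite planar graphs with `χ₁ = 3`. -/
theorem theorem1p3 :
    ∃ (n : ℕ → ℕ) (G : (i : ℕ) → SimpleGraph (Fin (n i))),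
      (∀ i, (G i).IsPlanar ∧ (G i).robustChromaticNumber = 3) ∧
      (∀ i j, i ≠ j → IsEmpty (G i ≃g G j)) := by
  refine ⟨fun i ↦ 70 + i, pagedCore, fun i ↦ ⟨pagedCore_isPlanar i,
    (robustChromaticNumber_pagedCore_le i).antisymm ?_⟩, fun i j hij ↦ ⟨fun e ↦ hij ?_⟩⟩
  · have h := Order.add_one_le_of_lt
      (not_le.1 (not_robustChromaticNumber_pagedCore_le_two i))
    exact le_trans (by norm_num) h
  · simpa using Fintype.card_congr e.toEquiv
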